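/- Let $X\subset\mathbf P^N(\mathbf C)$ be a projective variety and let $M=\mathcal O(1)|_X$ be the very ample line bundle defining the embedding, equipped with a smooth positive Hermitian metric $\Vert\cdot\Vert$ (that is, near every point of $X$, and for each homogeneous coordinate $x_i$ not vanishing there, the function $-\log\Vert x_i\Vert$ is the restriction to $X$ of a smooth strictly plurisubharmonic function on an open subset of $\mathbf P^N(\mathbf C)$). Let $\varphi:\mathbf C\to X$ be a holomorphic map. Let $\varphi^*(c_1(M))$ be the pull-back of the first Chern form, given locally by $-\frac{i}{\pi}\partial\bar\partial\log\Vert\varphi^*s\Vert$ for any local holomorphic section $s$ of $M$ with $\varphi^*s$ nowhere zero. Let $\Delta_r=\{z\in\mathbf C:\vert z\vert<r\}$ and, for $w_0\in\Delta_r$, let $$g_r(w_0,z)=\log\left\vert\frac{r^2-z\overline{w_0}}{r(z-w_0)}\right\vert\in[0,+\infty]\qquad(\vert z\vert\le r)$$ be the Green function of $\Delta_r$. Put $$T_{\varphi,M}(r)=\int_0^r\frac{dt}{t}\int_{\Delta_t}\varphi^*(c_1(M)),\qquad T_{\varphi,M,w_0}(r)=\int_0^1\frac{dt}{t}\int_{\{\vert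 z\vert\le r,\ \exp(-g_r(w_0,z))<t\}}\varphi^*(c_1(M)).$$ Then for every $r>0$ there is a set $E_r\subset\Delta_r$, which is the union of a countable family of open disks (possibly empty) the sum of whose radii is less than $\frac{5}{T_{\varphi,M}(r)}$ (read as $+\infty$ if $T_{\varphi,M}(r)=0$), such that for every $w_0\in\Delta_r\setminus E_r$, $$T_{\varphi,M,w_0}(r)\le\bigl(\log T_{\varphi,M}(r)+\log r+\log 2\bigr)\cdot T_{\varphi,M}(e\cdot r).$$ -/

import Mathlib

open MeasureTheory Topology
open scoped ENNReal NNReal ContDiff LinearAlgebra.Projectivization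

noncomputable section

namespace EntireCurve

/-- Complex projective space `ℙᴺ(ℂ)`: the lines of `ℂᴺ⁺¹`. -/
abbrev PSpace (N : ℕ) : Type := ℙ ℂ (Fin (N + 1) → ℂ)

/-- The common zero locus in `ℙᴺ(ℂ)` of a set of homogeneous polynomials. -/
def IsProjectiveAlgebraic {N : ℕ} (X : Set (PSpace N)) : Prop :=
  ∃ S : Set (MvPolynomial (Fin (N + 1)) ℂ),
    (∀ P ∈ S, ∃ d : ℕ, P.IsHomogeneous d) ∧
    X = {p | ∀ P ∈ S, ∀ v ∈ p.submodule, MvPolynomial.eval v P = 0}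

/-- The point `[w₀ : … : 1 : … : w_{N-1}]`, with `1` in position `i`: the inverse of the `i`-th
standard affine chart. -/
def affinePoint {N : ℕ} (i : Fin (N + 1)) (w : Fin N → ℂ) : PSpace N :=
  Projectivization.mk ℂ (i.insertNth (1 : ℂ) w : Fin (N + 1) → ℂ)
    (fun h => one_ne_zero (α := ℂ) (by simpa using congrFun h i))

/-- The fibre of `𝒪(1)` at `p`: the linear forms on the line `p`. -/
abbrev O1Fibre {N : ℕ} (p : PSpace N) : Type := Module.Dual ℂ p.submodule

/-- The value at `p` of the `i`-th homogeneous coordinate, a global section of `𝒪(1)`. -/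
def coordSection {N : ℕ} (i : Fin (N + 1)) (p : PSpace N) : O1Fibre p :=
  (LinearMap.proj i : (Fin (N + 1) → ℂ) →ₗ[ℂ] ℂ).domRestrict p.submodule

/-- A Hermitian metric on `𝒪(1)|_X`. The fibres are one-dimensional, so a Hermitian inner product
on a fibre is the same thing as a positive absolutely homogeneous function on it. -/
structure HermitianMetric {N : ℕ} (X : Set (PSpace N)) where
  /-- the norm on the fibre over `p` -/
  norm : ∀ p : X, O1Fibre p.1 → ℝ
  norm_smul : ∀ (p : X) (c : ℂ) (l : O1Fibre p.1), norm p (c • l) = ‖c‖ * norm p l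
  norm_pos : ∀ (p : X) (l : O1Fibre p.1), l ≠ 0 → 0 < norm p l

/-- `u` is smooth and strictly plurisubharmonic on the open set `U ⊆ ℂᴺ`: its Levi form, which in
the direction `ξ` is a quarter of the Laplacian of `t ↦ u (w + t ξ)` at `t = 0`, is positive
definite. -/
def IsStrictlyPSH {N : ℕ} (U : Set (Fin N → ℂ)) (u : (Fin N → ℂ) → ℝ) : Prop :=
  ContDiffOn ℝ ∞ u U ∧
    ∀ w ∈ U, ∀ ξ : Fin N → ℂ, ξ ≠ 0 →
      0 < Laplacian.laplacian (fun t : ℂ => u (w + t • ξ)) 0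

/-- The metric is smooth and positive: in each affine chart, the local weight `-log ‖x_i‖` is
locally the restriction to `X` of a smooth strictly plurisubharmonic function on an open subset of
the ambient space. Where `X` is smooth, this says that the metric is smooth with
curvature form `c₁` positive definite; it also makes sense at the singular points of `X`. -/
def HermitianMetric.IsPositive {N : ℕ} {X : Set (PSpace N)} (M : HermitianMetric X) : Prop :=
  ∀ (i : Fin (N + 1)) (w₀ : Fin N → ℂ), affinePoint i w₀ ∈ X →
    ∃ (U : Set (Fin N → ℂ)) (u : (Fin N → ℂ) → ℝ),
      IsOpen U ∧ w₀ ∈ U ∧ IsStrictlyPSH U u ∧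
      ∀ (w : Fin N → ℂ) (hw : affinePoint i w ∈ X), w ∈ U →
        u w = -Real.log (M.norm ⟨affinePoint i w, hw⟩ (coordSection i (affinePoint i w)))

/-- `φ : ℂ → X ⊆ ℙᴺ(ℂ)` is holomorphic: it has holomorphic homogeneous coordinates without
common zeros near every point. -/
def IsHolomorphicCurve {N : ℕ} {X : Set (PSpace N)} (φ : ℂ → X) : Prop :=
  ∀ z₀ : ℂ, ∃ (f : ℂ → Fin (N + 1) → ℂ) (hf : ∀ z, f z ≠ 0), AnalyticAt ℂ f z₀ ∧
    ∀ᶠ z in 𝓝 z₀, (φ z : PSpace N) = Projectivization.mk ℂ (f z) (hf z)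

/-- Some homogeneous coordinate does not vanish at `p`. -/
theorem exists_coordSection_ne_zero {N : ℕ} (p : PSpace N) : ∃ i, coordSection i p ≠ 0 := by
  by_contra! h
  apply p.rep_nonzero
  funext i
  have hp : p.rep ∈ p.submodule := by
    rw [p.submodule_eq]
    exact Submodule.mem_span_singleton_self _
  exact LinearMap.congr_fun (h i) ⟨p.rep, hp⟩

/-- The index of a homogeneous coordinate that does not vanish at `p`. -/
def frameIndex {N : ℕ} (p : PSpace N) : Fin (N + 1) :=
  (exists_coordSection_ne_zero p).choose

/-- The density of `φ^*(c₁(M))` with respect to Lebesgue measure `dx dy` on `ℂ`. As a form,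
`φ^*(c₁(M)) = -(i/π) ∂∂̄ log ‖s ∘ φ‖ = -(1/2π) Δ(log ‖s ∘ φ‖) dx dy` for any section `s` of
`𝒪(1)` without zeros near the point; another choice of `s` changes `log ‖s ∘ φ‖` by a harmonic
function. Here `s` is a homogeneous coordinate that does not vanish at the point. -/
def chernDensity {N : ℕ} {X : Set (PSpace N)} (M : HermitianMetric X) (φ : ℂ → X) (z : ℂ) : ℝ :=
  -(1 / (2 * Real.pi)) *
    Laplacian.laplacian
      (fun ζ : ℂ => Real.log (M.norm (φ ζ) (coordSection (frameIndex (φ z).1) (φ ζ).1))) z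

/-- `∫_A φ^*(c₁(M))`. -/
def chernMass {N : ℕ} {X : Set (PSpace N)} (M : HermitianMetric X) (φ : ℂ → X) (A : Set ℂ) : ℝ :=
  ∫ z in A, chernDensity M φ z

/-- The characteristic function `T_{φ,M}(r) = ∫₀^r (1/t) ∫_{Δ_t} φ^*(c₁(M)) dt`. -/
def charFun {N : ℕ} {X : Set (PSpace N)} (M : HermitianMetric X) (φ : ℂ → X) (r : ℝ) : ℝ :=
  ∫ t in (0 : ℝ)..r, 1 / t * chernMass M φ (Metric.ball 0 t)

/-- The Green function `g_r(w₀, z) = log |(r² - z w̄₀) / (r (z - w₀))|` of the disk `Δ_r`, with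
value `+∞` at `z = w₀`. -/
def green (r : ℝ) (w₀ z : ℂ) : EReal :=
  open scoped Classical in
  if z = w₀ then ⊤
  else ((Real.log ‖((r : ℂ) ^ 2 - z * (starRingEnd ℂ) w₀) / ((r : ℂ) * (z - w₀))‖ : ℝ) : EReal)

/-- The set of the `z` in the closed disk of radius `r` with `exp(-g_r(w₀, z)) < t`. -/
def greenSublevel (r : ℝ) (w₀ : ℂ) (t : ℝ) : Set ℂ :=
  {z | ‖z‖ ≤ r ∧ EReal.exp (-green r w₀ z) < ENNReal.ofReal t}

/-- The characteristic function with respect to the base point `w₀`,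
`T_{φ,M,w₀}(r) = ∫₀¹ (1/t) ∫_{exp(-g_r(w₀, z)) < t} φ^*(c₁(M)) dt`. -/
def charFunAt {N : ℕ} {X : Set (PSpace N)} (M : HermitianMetric X) (φ : ℂ → X) (w₀ : ℂ)
    (r : ℝ) : ℝ :=
  ∫ t in (0 : ℝ)..1, 1 / t * chernMass M φ (greenSublevel r w₀ t)

end EntireCurve

end

/-!
The density `h` of `φ^* c₁(M)` is continuous and nonnegative: in an affine chart it is the Laplacian
of a smooth plurisubharmonic function along a holomorphic map, up to the choice of the section,
which only adds a harmonic function. All that follows is about the measure `μ = h(z) dx dy`.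

By Tonelli, `T(R)` is the integral of `log (R / ‖z‖)` over the disk of radius `R`, and `T_w(r)` is
the Green potential `∫ g_r(w, z) dμ(z)`. Hence `m := T(e r)` is at least the total mass of the
measure `ν = (1 + log (r / ‖z‖)) μ` on the closed disk of radius `r`. With `s = ‖z - w‖`, the Green
function satisfies
* `g_r(w, z) ≤ log (1 + 2 (r - ‖w‖) / s)`, useful near the boundary, and
* `g_r(w, z) ≤ (1 + log (r / ‖z‖)) log (1 + (3 / 5) r / s)`, useful inside,

so that the Green potential is bounded by a logarithmic potential of `ν`
(`lintegral_log_expNegGreen_le`).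

If `r T(r) < 5`, the whole disk may be exceptional. Otherwise let `κ = (5 / 8) m T(r)`. A point `w`
is called good if the disk of radius `t` about `w` has `ν`-mass at most `κ t` for every
`t ≤ (10 / 31) (r - ‖w‖)`. At a good point the logarithmic potential up to the scale
`D = min ((10 / 31) (r - ‖w‖)) (m / κ)` is at most `κ D`, and the required bound reduces to the
inequality `log (1 + c / D) + (5 / 8) T(r) D ≤ log (2 r T(r))` of `exists_log_add_le`.
The bad points are covered by Vitali's covering lemma with enlargement factor `31 / 10`
(`exists_balls_covering`): disjointness bounds the sum of the radii by
`(31 / 10) m / κ < 5 / T(r)`, and the limit on `t` keeps the enlarged disks inside the disk of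
radius `r`.
-/

namespace EntireCurve

open Laplacian InnerProductSpace

/-! ### Curvature density of the pulled back metric -/

/-- The second derivative of `u ∘ W` in the direction `e`. The term with `W''` carries the factor
`e ^ 2`, so that it cancels between `e = 1` and `e = I`. -/
theorem fderiv_fderiv_comp_holomorphic {N : ℕ} {u : (Fin N → ℂ) → ℝ} {W : ℂ → Fin N → ℂ} {z : ℂ}
    (hu : ContDiffAt ℝ 2 u (W z)) (hW : AnalyticAt ℂ W z) (e : ℂ) :
    fderiv ℝ (fderiv ℝ (fun ζ => u (W ζ))) z e e =
      fderiv ℝ (fderiv ℝ u) (W z) (e • deriv W z) (e • deriv W z) +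
        fderiv ℝ u (W z) (e • e • deriv (deriv W) z) := by
  have hdW : ∀ {g : ℂ → Fin N → ℂ} {ζ : ℂ}, AnalyticAt ℂ g ζ →
      HasFDerivAt g (((1 : ℂ →L[ℂ] ℂ).smulRight (deriv g ζ)).restrictScalars ℝ) ζ :=
    fun hg => hg.differentiableAt.hasDerivAt.hasFDerivAt.restrictScalars ℝ
  have hWR : ContDiffAt ℝ 2 W z := (hW.contDiffAt (n := 2)).restrict_scalars ℝ
  have hcomp : ContDiffAt ℝ 2 (fun ζ => u (W ζ)) z := hu.comp z hWR
  have hd : DifferentiableAt ℝ (fderiv ℝ (fun ζ => u (W ζ))) z :=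
    (hcomp.fderiv_right (m := 1) (by norm_num)).differentiableAt (by norm_num)
  have hdu : DifferentiableAt ℝ (fderiv ℝ u) (W z) :=
    (hu.fderiv_right (m := 1) (by norm_num)).differentiableAt (by norm_num)
  have h1 : fderiv ℝ (fderiv ℝ (fun ζ => u (W ζ))) z e e =
      fderiv ℝ (fun ζ => fderiv ℝ (fun ζ => u (W ζ)) ζ e) z e := by
    rw [fderiv_clm_apply hd (differentiableAt_const e)]
    simp
  have h2 : (fun ζ => fderiv ℝ (fun ζ => u (W ζ)) ζ e) =ᶠ[𝓝 z]
      fun ζ => fderiv ℝ u (W ζ) (e • deriv W ζ) := by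
    have hu' : ∀ᶠ w in 𝓝 (W z), DifferentiableAt ℝ u w :=
      (hu.eventually (by simp)).mono fun w hw => hw.differentiableAt (by norm_num)
    filter_upwards [hW.eventually_analyticAt, hW.continuousAt.eventually hu'] with ζ h3 h4
    have := (h4.hasFDerivAt.comp ζ (hdW h3)).fderiv
    simp only [Function.comp_def] at this
    rw [this]
    simp
  rw [h1, h2.fderiv_eq]
  have h5 : HasFDerivAt (fun ζ => fderiv ℝ u (W ζ)) _ z := hdu.hasFDerivAt.comp z (hdW hW)
  have h6 : HasFDerivAt (fun ζ => e • deriv W ζ) _ z := (hdW hW.deriv).const_smul e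
  rw [(h5.clm_apply h6).fderiv]
  simp [add_comm]

/-- The Laplacian of `u ∘ W`, for `W` holomorphic, is the Levi form of `u` in the direction `W'`
(up to the factor `4`): the terms that contain `W''` cancel. -/
theorem laplacian_comp_holomorphic {N : ℕ} {u : (Fin N → ℂ) → ℝ} {W : ℂ → Fin N → ℂ} {z : ℂ}
    (hu : ContDiffAt ℝ 2 u (W z)) (hW : AnalyticAt ℂ W z) :
    Δ (fun ζ => u (W ζ)) z = Δ (fun t : ℂ => u (W z + t • deriv W z)) 0 := by
  have key : ∀ {V : ℂ → Fin N → ℂ} {y : ℂ}, ContDiffAt ℝ 2 u (V y) → AnalyticAt ℂ V y →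
      Δ (fun ζ => u (V ζ)) y = fderiv ℝ (fderiv ℝ u) (V y) (deriv V y) (deriv V y) +
        fderiv ℝ (fderiv ℝ u) (V y) (Complex.I • deriv V y) (Complex.I • deriv V y) := by
    intro V y hu hV
    rw [laplacian_eq_iteratedFDeriv_complexPlane]
    simp only [iteratedFDeriv_two_apply, Matrix.cons_val_zero, Matrix.cons_val_one]
    rw [fderiv_fderiv_comp_holomorphic hu hV, fderiv_fderiv_comp_holomorphic hu hV]
    simp only [one_smul, smul_smul, Complex.I_mul_I, neg_smul, map_neg]
    ring
  have hA : AnalyticAt ℂ (fun t : ℂ => W z + t • deriv W z) 0 := by fun_prop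
  have hd : deriv (fun t : ℂ => W z + t • deriv W z) 0 = deriv W z := by
    have := ((hasDerivAt_id (0 : ℂ)).smul_const (deriv W z)).const_add (W z)
    simpa using this.deriv
  rw [key hu hW, key (V := fun t : ℂ => W z + t • deriv W z) (by simpa using hu) hA, hd]
  simp

theorem coordSection_eq_smul {N : ℕ} {p : PSpace N} {v : Fin (N + 1) → ℂ} {hv : v ≠ 0}
    (hp : p = Projectivization.mk ℂ v hv) {i : Fin (N + 1)} (hi : v i ≠ 0) (k : Fin (N + 1)) :
    coordSection k p = (v k / v i) • coordSection i p := by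
  subst hp
  ext ⟨x, hx⟩
  rw [Projectivization.submodule_mk, Submodule.mem_span_singleton] at hx
  obtain ⟨c, rfl⟩ := hx
  simp only [coordSection, LinearMap.domRestrict_apply, LinearMap.smul_apply, LinearMap.proj_apply,
    Pi.smul_apply, smul_eq_mul]
  field_simp

theorem coordSection_ne_zero_iff {N : ℕ} {p : PSpace N} {v : Fin (N + 1) → ℂ} {hv : v ≠ 0}
    (hp : p = Projectivization.mk ℂ v hv) (k : Fin (N + 1)) :
    coordSection k p ≠ 0 ↔ v k ≠ 0 := by
  subst hp
  have hmem : v ∈ (Projectivization.mk ℂ v hv).submodule := by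
    rw [Projectivization.submodule_mk]
    exact Submodule.mem_span_singleton_self _
  constructor
  · intro h hk
    apply h
    obtain ⟨i, hi⟩ := Function.ne_iff.mp hv
    rw [coordSection_eq_smul rfl hi k, hk]
    simp
  · intro hk h
    exact hk (LinearMap.congr_fun h ⟨v, hmem⟩)

theorem mk_eq_affinePoint {N : ℕ} {v : Fin (N + 1) → ℂ} (hv : v ≠ 0) {i : Fin (N + 1)}
    (hi : v i ≠ 0) :
    Projectivization.mk ℂ v hv = affinePoint i (fun j => v (i.succAbove j) / v i) := by
  rw [affinePoint, Projectivization.mk_eq_mk_iff']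
  refine ⟨v i, funext fun k => ?_⟩
  refine Fin.succAboveCases i ?_ (fun j => ?_) k
  · simp
  · simp only [Pi.smul_apply, Fin.insertNth_apply_succAbove, smul_eq_mul]
    field_simp

/-- Near every point, the density of `φ^* c₁(M)` is the normalized Laplacian of a smooth strictly
plurisubharmonic function along the curve read in an affine chart. The index chosen in
`chernDensity` may jump, but `log |f_k / f_i|` is harmonic. -/
theorem chernDensity_eventuallyEq {N : ℕ} {X : Set (PSpace N)} {M : HermitianMetric X}
    (hM : M.IsPositive) {φ : ℂ → X} (hφ : IsHolomorphicCurve φ) (z₀ : ℂ) :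
    ∃ (U : Set (Fin N → ℂ)) (u : (Fin N → ℂ) → ℝ) (W : ℂ → Fin N → ℂ),
      IsOpen U ∧ W z₀ ∈ U ∧ IsStrictlyPSH U u ∧ AnalyticAt ℂ W z₀ ∧
      ∀ᶠ z in 𝓝 z₀, chernDensity M φ z = 1 / (2 * Real.pi) * Δ (fun ζ => u (W ζ)) z := by
  obtain ⟨f, hf, hfa, hfφ⟩ := hφ z₀
  obtain ⟨i, hi⟩ := Function.ne_iff.mp (hf z₀)
  have hcoord : ∀ {z : ℂ}, AnalyticAt ℂ f z → ∀ j, AnalyticAt ℂ (fun ζ => f ζ j) z :=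
    fun h j => (analyticAt_pi_iff.mp h) j
  set W : ℂ → Fin N → ℂ := fun z j => f z (i.succAbove j) / f z i with hWdef
  have hWan : ∀ {z : ℂ}, AnalyticAt ℂ f z → f z i ≠ 0 → AnalyticAt ℂ W z := fun h hz =>
    analyticAt_pi_iff.mpr fun j => (hcoord h _).div (hcoord h i) hz
  have hW := hWan hfa hi
  have hφW : ∀ {z : ℂ}, (φ z : PSpace N) = Projectivization.mk ℂ (f z) (hf z) → f z i ≠ 0 →
      (φ z : PSpace N) = affinePoint i (W z) := fun h hz => h.trans (mk_eq_affinePoint _ hz)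
  have hX : affinePoint i (W z₀) ∈ X := hφW hfφ.self_of_nhds hi ▸ (φ z₀).2
  obtain ⟨U, u, hU, hz₀U, hu, huM⟩ := hM i (W z₀) hX
  refine ⟨U, u, W, hU, hz₀U, hu, hW, ?_⟩
  have hgood : ∀ᶠ z in 𝓝 z₀, AnalyticAt ℂ f z ∧ f z i ≠ 0 ∧ W z ∈ U ∧
      (φ z : PSpace N) = Projectivization.mk ℂ (f z) (hf z) := by
    filter_upwards [hfa.eventually_analyticAt, (hcoord hfa i).continuousAt.eventually_ne hi,
      hW.continuousAt.eventually (hU.mem_nhds hz₀U), hfφ] with z h1 h2 h3 h4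
    exact ⟨h1, h2, h3, h4⟩
  filter_upwards [hgood.eventually_nhds] with z hz
  obtain ⟨hza, hzi, hzU, hzφ⟩ := hz.self_of_nhds
  set k := frameIndex (φ z).1 with hk
  have hzk : f z k ≠ 0 :=
    (coordSection_ne_zero_iff hzφ k).mp (exists_coordSection_ne_zero (φ z).1).choose_spec
  have heq : (fun ζ : ℂ => Real.log (M.norm (φ ζ) (coordSection k (φ ζ).1))) =ᶠ[𝓝 z]
      (fun ζ => Real.log ‖f ζ k / f ζ i‖) - fun ζ => u (W ζ) := by
    filter_upwards [hz, (hcoord hza k).continuousAt.eventually_ne hzk] with ζ hζ hζk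
    obtain ⟨hζa, hζi, hζU, hζφ⟩ := hζ
    have hp := hφW hζφ hζi
    have hX : affinePoint i (W ζ) ∈ X := hp ▸ (φ ζ).2
    have h1 := huM (W ζ) hX hζU
    have h2 : φ ζ = ⟨affinePoint i (W ζ), hX⟩ := Subtype.ext hp
    have h3 : M.norm (φ ζ) (coordSection i (φ ζ).1) =
        M.norm ⟨affinePoint i (W ζ), hX⟩ (coordSection i (affinePoint i (W ζ))) := by rw [h2]
    have h4 : 0 < M.norm (φ ζ) (coordSection i (φ ζ).1) :=
      M.norm_pos _ _ ((coordSection_ne_zero_iff hζφ i).mpr hζi)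
    have h5 : ‖f ζ k / f ζ i‖ ≠ 0 := norm_ne_zero_iff.mpr (div_ne_zero hζk hζi)
    rw [coordSection_eq_smul hζφ hζi k, M.norm_smul, Real.log_mul h5 h4.ne', Pi.sub_apply, h1, h3]
    ring
  have hharm : HarmonicAt (fun ζ => Real.log ‖f ζ k / f ζ i‖) z :=
    AnalyticAt.harmonicAt_log_norm ((hcoord hza k).div (hcoord hza i) hzi) (div_ne_zero hzk hzi)
  have huW : ContDiffAt ℝ 2 (fun ζ => u (W ζ)) z :=
    ((hu.1.contDiffAt (hU.mem_nhds hzU)).of_le (WithTop.coe_le_coe.mpr le_top)).comp z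
      (((hWan hza hzi).contDiffAt (n := 2)).restrict_scalars ℝ)
  have h0 : Δ (fun ζ => Real.log ‖f ζ k / f ζ i‖) z = 0 := hharm.2.self_of_nhds
  rw [chernDensity, ← hk, (laplacian_congr_nhds heq).self_of_nhds,
    ContDiffAt.laplacian_sub hharm.1 huW]
  rw [h0]
  ring

theorem continuous_chernDensity {N : ℕ} {X : Set (PSpace N)} {M : HermitianMetric X}
    (hM : M.IsPositive) {φ : ℂ → X} (hφ : IsHolomorphicCurve φ) :
    Continuous (chernDensity M φ) := by
  refine continuous_iff_continuousAt.mpr fun z₀ => ?_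
  obtain ⟨U, u, W, hU, hz₀, hu, hW, h⟩ := chernDensity_eventuallyEq hM hφ z₀
  have huW : ContDiffAt ℝ ∞ (fun ζ => u (W ζ)) z₀ :=
    (hu.1.contDiffAt (hU.mem_nhds hz₀)).comp z₀ (hW.contDiffAt.restrict_scalars ℝ)
  have hd : ContinuousAt (iteratedFDeriv ℝ 2 (fun ζ => u (W ζ))) z₀ :=
    (huW.iteratedFDeriv_right (m := 0) (i := 2) (WithTop.coe_le_coe.mpr le_top)).continuousAt
  refine ContinuousAt.congr ?_ (Filter.EventuallyEq.symm h)
  simp only [laplacian_eq_iteratedFDeriv_complexPlane]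
  have happ : ∀ m : Fin 2 → ℂ,
      ContinuousAt (fun z => iteratedFDeriv ℝ 2 (fun ζ => u (W ζ)) z m) z₀ := fun m =>
    (ContinuousMultilinearMap.apply ℝ (fun _ : Fin 2 => ℂ) ℝ m).continuous.continuousAt.comp hd
  exact continuousAt_const.mul ((happ _).add (happ _))

theorem chernDensity_nonneg {N : ℕ} {X : Set (PSpace N)} {M : HermitianMetric X}
    (hM : M.IsPositive) {φ : ℂ → X} (hφ : IsHolomorphicCurve φ) (z : ℂ) :
    0 ≤ chernDensity M φ z := by
  obtain ⟨U, u, W, hU, hz, hu, hW, h⟩ := chernDensity_eventuallyEq hM hφ z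
  rw [h.self_of_nhds, laplacian_comp_holomorphic
    ((hu.1.contDiffAt (hU.mem_nhds hz)).of_le (WithTop.coe_le_coe.mpr le_top)) hW]
  refine mul_nonneg (by positivity) ?_
  rcases eq_or_ne (deriv W z) 0 with h0 | h0
  · simp only [h0, smul_zero, add_zero]
    rw [show (fun _ : ℂ => u (W z)) = fun _ => u (W z) from rfl, laplacian_const]
    simp
  · exact (hu.2 _ hz _ h0).le

/-! ### Logarithmic integrals by Tonelli -/

theorem setLIntegral_inv_Ioc {q R : ℝ} (hq : 0 < q) (hR : 0 < R) :
    ∫⁻ t in Set.Ioc q R, ENNReal.ofReal (1 / t) = ENNReal.ofReal (Real.log (R / q)) := by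
  rcases le_or_gt R q with h | h
  · rw [Set.Ioc_eq_empty (not_lt.mpr h), Measure.restrict_empty, lintegral_zero_measure, eq_comm,
      ENNReal.ofReal_eq_zero]
    exact Real.log_nonpos (by positivity) ((div_le_one hq).mpr h)
  · rw [← integral_one_div_of_pos hq (hq.trans h), intervalIntegral.integral_of_le h.le,
      ofReal_integral_eq_lintegral_ofReal]
    · refine (intervalIntegrable_iff_integrableOn_Ioc_of_le h.le).mp ?_
      refine intervalIntegral.intervalIntegrable_one_div (fun x hx => ?_) continuousOn_id
      rw [Set.uIcc_of_le h.le] at hx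
      exact (hq.trans_le hx.1).ne'
    · filter_upwards [ae_restrict_mem measurableSet_Ioc] with t ht
      exact (one_div_pos.mpr (hq.trans ht.1)).le

/-- The layer cake formula for `log (R / q)`. It computes both characteristic functions as
integrals of Green functions, and it bounds logarithmic potentials by the mass of disks. -/
theorem lintegral_inv_mul_measure_sublevel {μ : Measure ℂ} [SFinite μ] {q : ℂ → ℝ}
    (hq : Measurable q) {A : Set ℂ} (hA : MeasurableSet A) (hpos : ∀ᵐ z ∂μ, z ∈ A → 0 < q z)
    {R : ℝ} (hR : 0 < R) :
    ∫⁻ t in Set.Ioc 0 R, ENNReal.ofReal (1 / t) * μ {z | z ∈ A ∧ q z < t} =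
      ∫⁻ z in A, ENNReal.ofReal (Real.log (R / q z)) ∂μ := by
  have hS : MeasurableSet {p : ℝ × ℂ | p.2 ∈ A ∧ q p.2 < p.1} :=
    (measurable_snd hA).inter (measurableSet_lt (hq.comp measurable_snd) measurable_fst)
  have h1 : ∀ t : ℝ, ENNReal.ofReal (1 / t) * μ {z | z ∈ A ∧ q z < t} =
      ∫⁻ z, {p : ℝ × ℂ | p.2 ∈ A ∧ q p.2 < p.1}.indicator
        (fun p => ENNReal.ofReal (1 / p.1)) (t, z) ∂μ := by
    intro t
    have hT : MeasurableSet {z | z ∈ A ∧ q z < t} := measurable_prodMk_left hS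
    rw [← lintegral_indicator_const hT]
    refine lintegral_congr fun z => ?_
    by_cases h : z ∈ A ∧ q z < t <;> simp [h]
  simp_rw [h1]
  rw [lintegral_lintegral_swap, ← lintegral_indicator hA]
  · refine lintegral_congr_ae ?_
    filter_upwards [hpos] with z hz
    by_cases hzA : z ∈ A
    · have h2 : ∀ t : ℝ, {p : ℝ × ℂ | p.2 ∈ A ∧ q p.2 < p.1}.indicator
          (fun p => ENNReal.ofReal (1 / p.1)) (t, z) =
          (Set.Ioi (q z)).indicator (fun t => ENNReal.ofReal (1 / t)) t := by
        intro t
        by_cases h : q z < t <;> simp [h, hzA]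
      simp_rw [h2]
      rw [lintegral_indicator measurableSet_Ioi, Measure.restrict_restrict measurableSet_Ioi,
        Set.indicator_of_mem hzA, ← setLIntegral_inv_Ioc (hz hzA) hR]
      congr 2
      ext t
      simp only [Set.mem_inter_iff, Set.mem_Ioi, Set.mem_Ioc]
      constructor
      · rintro ⟨a, -, b⟩
        exact ⟨a, b⟩
      · rintro ⟨a, b⟩
        exact ⟨a, (hz hzA).trans a, b⟩
    · simp [hzA]
  · exact (Measurable.indicator (by fun_prop) hS).aemeasurable

/-- A measure that gives the disk of radius `t` about `w` at most the mass `κ t`, for `t ≤ D`, has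
logarithmic potential at most `κ D` there. -/
theorem lintegral_log_le_of_measure_closedBall_le {ν : Measure ℂ} [SFinite ν] {w : ℂ} {κ D : ℝ}
    (hD : 0 < D) (hκ : 0 ≤ κ)
    (h : ∀ t, 0 < t → t ≤ D → ν (Metric.closedBall w t) ≤ ENNReal.ofReal (κ * t))
    (hw : ν {w} = 0) :
    ∫⁻ z, ENNReal.ofReal (Real.log (D / ‖z - w‖)) ∂ν ≤ ENNReal.ofReal (κ * D) := by
  have hpos : ∀ᵐ z ∂ν, z ∈ Set.univ → 0 < ‖z - w‖ := by
    filter_upwards [compl_mem_ae_iff.mpr hw] with z hz _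
    exact norm_pos_iff.mpr (sub_ne_zero.mpr hz)
  have h1 := lintegral_inv_mul_measure_sublevel (μ := ν) (q := fun z => ‖z - w‖) (by fun_prop)
    MeasurableSet.univ hpos hD
  rw [Measure.restrict_univ] at h1
  rw [← h1]
  calc ∫⁻ t in Set.Ioc 0 D, ENNReal.ofReal (1 / t) * ν {z | z ∈ Set.univ ∧ ‖z - w‖ < t}
      ≤ ∫⁻ _ in Set.Ioc 0 D, ENNReal.ofReal κ := by
        refine setLIntegral_mono measurable_const fun t ht => ?_
        have h2 : ν {z | z ∈ Set.univ ∧ ‖z - w‖ < t} ≤ ENNReal.ofReal (κ * t) := by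
          refine (measure_mono ?_).trans (h t ht.1 ht.2)
          rintro z ⟨-, hz⟩
          exact mem_closedBall_iff_norm.mpr (le_of_lt hz)
        refine (mul_le_mul_right h2 _).trans ?_
        rw [← ENNReal.ofReal_mul (one_div_pos.mpr ht.1).le]
        refine le_of_eq (congrArg _ ?_)
        have := ht.1.ne'
        field_simp
    _ = ENNReal.ofReal (κ * D) := by
        rw [setLIntegral_const, Real.volume_Ioc, sub_zero, ← ENNReal.ofReal_mul hκ]

/-! ### Pointwise bounds for the Green function -/

/-- `exp (-g_r(w, z))`, the pseudo-hyperbolic distance of `w` and `z` in the disk of radius `r`. -/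
noncomputable def expNegGreen (r : ℝ) (w z : ℂ) : ℝ :=
  r * ‖z - w‖ / ‖(r : ℂ) ^ 2 - z * (starRingEnd ℂ) w‖

theorem measurable_expNegGreen (r : ℝ) (w : ℂ) : Measurable (expNegGreen r w) := by
  unfold expNegGreen
  fun_prop

theorem norm_sq_sub_mul_conj_sq (r : ℝ) (w z : ℂ) :
    ‖(r : ℂ) ^ 2 - z * (starRingEnd ℂ) w‖ ^ 2 =
      r ^ 2 * ‖z - w‖ ^ 2 + (r ^ 2 - ‖z‖ ^ 2) * (r ^ 2 - ‖w‖ ^ 2) := by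
  simp only [← Complex.normSq_eq_norm_sq, Complex.normSq_apply]
  simp [pow_two]
  ring

theorem norm_sq_sub_mul_conj_pos {r : ℝ} {w z : ℂ} (hw : ‖w‖ < r) (hz : ‖z‖ ≤ r) :
    0 < ‖(r : ℂ) ^ 2 - z * (starRingEnd ℂ) w‖ := by
  have hr : 0 < r := (norm_nonneg w).trans_lt hw
  refine norm_pos_iff.mpr fun h => ?_
  have h1 : ‖(r : ℂ) ^ 2‖ = ‖z * (starRingEnd ℂ) w‖ := by rw [sub_eq_zero.mp h]
  rw [norm_mul, RCLike.norm_conj, norm_pow, Complex.norm_real, Real.norm_of_nonneg hr.le] at h1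
  nlinarith [norm_nonneg w, norm_nonneg z]

theorem expNegGreen_pos {r : ℝ} {w z : ℂ} (hw : ‖w‖ < r) (hz : ‖z‖ ≤ r) (hzw : z ≠ w) :
    0 < expNegGreen r w z :=
  div_pos (mul_pos ((norm_nonneg w).trans_lt hw) (norm_pos_iff.mpr (sub_ne_zero.mpr hzw)))
    (norm_sq_sub_mul_conj_pos hw hz)

theorem greenSublevel_eq {r : ℝ} {w : ℂ} (hw : ‖w‖ < r) {t : ℝ} (ht : 0 < t) :
    greenSublevel r w t = {z | z ∈ Metric.closedBall 0 r ∧ expNegGreen r w z < t} := by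
  have hr : 0 < r := (norm_nonneg w).trans_lt hw
  ext z
  simp only [greenSublevel, Set.mem_ofPred_eq, mem_closedBall_zero_iff]
  refine and_congr_right fun hz => ?_
  by_cases hzw : z = w
  · simp [green, hzw, expNegGreen, ht]
  · have h0 := expNegGreen_pos hw hz hzw
    have h1 : Real.exp (-Real.log
        ‖((r : ℂ) ^ 2 - z * (starRingEnd ℂ) w) / ((r : ℂ) * (z - w))‖) = expNegGreen r w z := by
      rw [Real.exp_neg, Real.exp_log, expNegGreen, norm_div, norm_mul, Complex.norm_real,
        Real.norm_of_nonneg hr.le, inv_div]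
      refine norm_pos_iff.mpr (div_ne_zero (norm_pos_iff.mp (norm_sq_sub_mul_conj_pos hw hz)) ?_)
      exact mul_ne_zero (by exact_mod_cast hr.ne') (sub_ne_zero.mpr hzw)
    rw [green, if_neg hzw, ← EReal.coe_neg, EReal.exp_coe, h1,
      ENNReal.ofReal_lt_ofReal_iff_of_nonneg h0.le]

/-- Near the boundary of the disk, the Green function decays with the distance `r - ‖w‖`. -/
theorem log_inv_expNegGreen_le_boundary {r : ℝ} {w z : ℂ} (hw : ‖w‖ < r) (hz : ‖z‖ ≤ r)
    (hzw : z ≠ w) :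
    Real.log (1 / expNegGreen r w z) ≤ Real.log (1 + 2 * (r - ‖w‖) / ‖z - w‖) := by
  have hr : 0 < r := (norm_nonneg w).trans_lt hw
  have hs : 0 < ‖z - w‖ := norm_pos_iff.mpr (sub_ne_zero.mpr hzw)
  have ha := norm_nonneg w
  have hb := norm_nonneg z
  have hab : ‖w‖ ≤ ‖z‖ + ‖z - w‖ := by
    have := norm_sub_le z (z - w)
    simpa using this
  refine Real.log_le_log (one_div_pos.mpr (expNegGreen_pos hw hz hzw)) ?_
  rw [expNegGreen, one_div_div, div_le_iff₀ (mul_pos hr hs)]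
  have h1 : (1 + 2 * (r - ‖w‖) / ‖z - w‖) * (r * ‖z - w‖) = r * (‖z - w‖ + 2 * (r - ‖w‖)) := by
    field_simp
  rw [h1]
  refine (pow_le_pow_iff_left₀ (norm_nonneg _) (by nlinarith) two_ne_zero).mp ?_
  rw [norm_sq_sub_mul_conj_sq]
  have h2 : r ^ 2 - ‖z‖ ^ 2 ≤ 2 * r * (r - ‖w‖ + ‖z - w‖) := by nlinarith
  have h3 : r ^ 2 - ‖w‖ ^ 2 ≤ 2 * r * (r - ‖w‖) := by nlinarith
  have h4 := mul_le_mul h2 h3 (by nlinarith) (by nlinarith)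
  nlinarith

/-- The Green function of the disk with pole at `w`, compared with the density
`1 + log (r / ‖z‖)` that the larger disk of radius `e r` provides. Bernoulli's inequality
reduces it to the bound `‖r² - z w̄‖ ≤ r (s + (3 / 5) (2 r - ‖z‖))` with `s = ‖z - w‖`. -/
theorem log_inv_expNegGreen_le_weight {r : ℝ} {w z : ℂ} (hw : ‖w‖ < r) (hz : ‖z‖ ≤ r)
    (hzw : z ≠ w) (hz0 : z ≠ 0) :
    Real.log (1 / expNegGreen r w z) ≤
      (1 + Real.log (r / ‖z‖)) * Real.log (1 + 3 / 5 * r / ‖z - w‖) := by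
  have hr : 0 < r := (norm_nonneg w).trans_lt hw
  have hs : 0 < ‖z - w‖ := norm_pos_iff.mpr (sub_ne_zero.mpr hzw)
  have ha := norm_nonneg w
  have hb : 0 < ‖z‖ := norm_pos_iff.mpr hz0
  have hba : ‖z‖ ≤ ‖w‖ + ‖z - w‖ := by
    have := norm_add_le w (z - w)
    simpa using this
  have hP := norm_sq_sub_mul_conj_sq r w z
  set s := ‖z - w‖
  set a := ‖w‖
  set b := ‖z‖
  set P := ‖(r : ℂ) ^ 2 - z * (starRingEnd ℂ) w‖ with hPdef
  have hy : 1 - b / r ≤ Real.log (r / b) := by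
    have := Real.one_sub_inv_le_log_of_pos (div_pos hr hb)
    rwa [inv_div] at this
  have hbr : b / r ≤ 1 := (div_le_one hr).mpr hz
  -- `3 / 5` is large enough for `r ^ 2 - b ^ 2 ≤ r * X` on all of `[0, r]`: at `s = 0` this is
  -- exactly what the bound on `P` says.
  obtain ⟨X, hX⟩ : ∃ X, X = 3 / 5 * (2 * r - b) := ⟨_, rfl⟩
  have hX0 : 0 < X := by rw [hX]; linarith
  have hX1 : r ^ 2 - b ^ 2 ≤ r * X := by
    rw [hX]
    nlinarith [sq_nonneg (b - 3 / 10 * r), sq_nonneg r]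
  have hb2 : 0 ≤ r ^ 2 - b ^ 2 := by nlinarith
  have hpoly : (r ^ 2 - b ^ 2) * (r ^ 2 - a ^ 2) ≤ r ^ 2 * (X ^ 2 + 2 * s * X) := by
    rcases le_or_gt s b with hsb | hsb
    · have h1 : r ^ 2 - a ^ 2 ≤ (r ^ 2 - b ^ 2) + 2 * b * s := by nlinarith
      calc (r ^ 2 - b ^ 2) * (r ^ 2 - a ^ 2)
          ≤ (r ^ 2 - b ^ 2) * ((r ^ 2 - b ^ 2) + 2 * b * s) := mul_le_mul_of_nonneg_left h1 hb2
        _ ≤ (r * X) * (r * X + 2 * r * s) := by gcongr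
        _ = r ^ 2 * (X ^ 2 + 2 * s * X) := by ring
    · have h1 : r ≤ X + b := by rw [hX]; linarith
      have h2 : r ^ 2 - b ^ 2 ≤ X ^ 2 + 2 * s * X := by nlinarith
      calc (r ^ 2 - b ^ 2) * (r ^ 2 - a ^ 2) ≤ (r ^ 2 - b ^ 2) * r ^ 2 :=
            mul_le_mul_of_nonneg_left (by nlinarith) hb2
        _ ≤ (X ^ 2 + 2 * s * X) * r ^ 2 := mul_le_mul_of_nonneg_right h2 (sq_nonneg r)
        _ = _ := by ring
  have hPle : P ≤ r * (s + X) := by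
    refine (pow_le_pow_iff_left₀ (norm_nonneg _) (by positivity) two_ne_zero).mp ?_
    rw [hP]
    nlinarith
  have hE := expNegGreen_pos hw hz hzw
  have hbern := one_add_mul_self_le_rpow_one_add (s := 3 / 5 * r / s) (by
    have : 0 ≤ 3 / 5 * r / s := by positivity
    linarith) (p := 1 + Real.log (r / b)) (by linarith)
  have hle : 1 / expNegGreen r w z ≤ (1 + 3 / 5 * r / s) ^ (1 + Real.log (r / b)) := by
    refine le_trans ?_ hbern
    rw [expNegGreen, one_div_div, div_le_iff₀ (mul_pos hr hs)]
    refine hPle.trans ?_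
    have h1 : (1 + (1 + Real.log (r / b)) * (3 / 5 * r / s)) * (r * s) =
        r * (s + 3 / 5 * (r * (1 + Real.log (r / b)))) := by
      field_simp
    rw [h1, hX]
    have h2 : 2 * r - b ≤ r * (1 + Real.log (r / b)) := by
      have h3 := mul_le_mul_of_nonneg_left hy hr.le
      have h4 : r * (1 - b / r) = r - b := by field_simp
      linarith
    gcongr
  have h6 := Real.log_le_log (one_div_pos.mpr hE) hle
  rwa [Real.log_rpow (by positivity)] at h6

/-! ### Densities on the plane and their characteristic functions -/

/-- The measure `h(z) dx dy` on the plane. -/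
noncomputable def densityMeasure (h : ℂ → ℝ) : Measure ℂ :=
  volume.withDensity fun z => ENNReal.ofReal (h z)

instance (h : ℂ → ℝ) : SFinite (densityMeasure h) := by
  unfold densityMeasure
  infer_instance

section Density

variable {h : ℂ → ℝ}

theorem ae_ne_densityMeasure (h : ℂ → ℝ) (w : ℂ) : ∀ᵐ z ∂densityMeasure h, z ≠ w :=
  (withDensity_absolutelyContinuous _ _) (compl_mem_ae_iff.mpr (measure_singleton w))

theorem ofReal_setIntegral_eq (hc : Continuous h) (h0 : ∀ z, 0 ≤ h z) {A : Set ℂ}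
    (hA : MeasurableSet A) {r : ℝ} (hAr : A ⊆ Metric.closedBall 0 r) :
    ENNReal.ofReal (∫ z in A, h z) = densityMeasure h A := by
  have hi : IntegrableOn h A :=
    (hc.continuousOn.integrableOn_compact (isCompact_closedBall 0 r)).mono_set hAr
  rw [ofReal_integral_eq_lintegral_ofReal hi (.of_forall h0), densityMeasure,
    withDensity_apply _ hA]

theorem intervalIntegrable_charFun (hc : Continuous h) (h0 : ∀ z, 0 ≤ h z) {R : ℝ} (hR : 0 ≤ R) :
    IntervalIntegrable (fun t => 1 / t * ∫ z in Metric.ball 0 t, h z) volume 0 R := by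
  obtain ⟨C, hC⟩ := (isCompact_closedBall (0 : ℂ) R).exists_bound_of_continuousOn hc.continuousOn
  have hint : ∀ t, IntegrableOn h (Metric.ball 0 t) := fun t =>
    (hc.continuousOn.integrableOn_compact (isCompact_closedBall 0 t)).mono_set
      Metric.ball_subset_closedBall
  have hmono : Monotone fun t : ℝ => ∫ z in Metric.ball 0 t, h z := fun s t hst =>
    setIntegral_mono_set (hint t) (.of_forall h0) (Metric.ball_subset_ball hst).eventuallyLE
  rw [intervalIntegrable_iff_integrableOn_Ioc_of_le hR]
  refine Measure.integrableOn_of_bounded (M := C * (R * Real.pi)) (by simp)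
    ((measurable_const.div measurable_id).mul hmono.measurable).aestronglyMeasurable ?_
  filter_upwards [ae_restrict_mem measurableSet_Ioc] with t ht
  have h1 : ‖∫ z in Metric.ball 0 t, h z‖ ≤ C * (t ^ 2 * Real.pi) := by
    have h2 := norm_setIntegral_le_of_norm_le_const (μ := volume) (s := Metric.ball (0 : ℂ) t)
      (f := h) (C := C) (measure_ball_lt_top) (fun z hz =>
        hC z (Metric.ball_subset_closedBall (Metric.ball_subset_ball ht.2 hz)))
    rw [Measure.real, Complex.volume_ball] at h2
    simpa [ht.1.le] using h2
  have hC0 : 0 ≤ C := (norm_nonneg _).trans (hC 0 (by simpa using hR))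
  rw [norm_mul, Real.norm_of_nonneg (one_div_pos.mpr ht.1).le]
  calc 1 / t * ‖∫ z in Metric.ball 0 t, h z‖ ≤ 1 / t * (C * (t ^ 2 * Real.pi)) := by
        have := ht.1
        gcongr
    _ = C * (t * Real.pi) := by
        have := ht.1.ne'
        field_simp
    _ ≤ C * (R * Real.pi) := by
        have := ht.2
        have := Real.pi_pos
        gcongr

/-- The characteristic function is the integral of the Green function with pole at the origin. -/
theorem ofReal_charFun_eq (hc : Continuous h) (h0 : ∀ z, 0 ≤ h z) {R : ℝ} (hR : 0 < R) :
    ENNReal.ofReal (∫ t in (0 : ℝ)..R, 1 / t * ∫ z in Metric.ball 0 t, h z) =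
      ∫⁻ z, ENNReal.ofReal (Real.log (R / ‖z‖)) ∂densityMeasure h := by
  have h1 := lintegral_inv_mul_measure_sublevel (μ := densityMeasure h) (q := fun z => ‖z‖)
    (by fun_prop) MeasurableSet.univ
    ((ae_ne_densityMeasure h 0).mono fun z hz _ => norm_pos_iff.mpr hz) hR
  rw [Measure.restrict_univ] at h1
  have h2 := intervalIntegrable_charFun hc h0 hR.le
  rw [← h1, intervalIntegral.integral_of_le hR.le, ofReal_integral_eq_lintegral_ofReal
    ((intervalIntegrable_iff_integrableOn_Ioc_of_le hR.le).mp h2)]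
  · refine setLIntegral_congr_fun measurableSet_Ioc fun t ht => ?_
    have h3 : {z : ℂ | z ∈ Set.univ ∧ ‖z‖ < t} = Metric.ball 0 t := by
      ext z
      simp
    rw [h3, ENNReal.ofReal_mul (one_div_pos.mpr ht.1).le,
      ofReal_setIntegral_eq hc h0 measurableSet_ball Metric.ball_subset_closedBall]
  · filter_upwards [ae_restrict_mem measurableSet_Ioc] with t ht
    exact mul_nonneg (one_div_pos.mpr ht.1).le (integral_nonneg h0)

/-- The characteristic function with base point `w` is at most the integral of the Green function
with pole at `w`. -/
theorem charFunAt_le_toReal_lintegral (hc : Continuous h) (h0 : ∀ z, 0 ≤ h z) {r : ℝ} {w : ℂ}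
    (hw : ‖w‖ < r) :
    ∫ t in (0 : ℝ)..1, 1 / t * ∫ z in greenSublevel r w t, h z ≤
      (∫⁻ z in Metric.closedBall 0 r, ENNReal.ofReal (Real.log (1 / expNegGreen r w z))
        ∂densityMeasure h).toReal := by
  have h1 := lintegral_inv_mul_measure_sublevel (μ := densityMeasure h) (q := expNegGreen r w)
    (measurable_expNegGreen r w) (Metric.isClosed_closedBall (x := (0 : ℂ)) (ε := r)).measurableSet
    ((ae_ne_densityMeasure h w).mono fun z hz hzr =>
      expNegGreen_pos hw (mem_closedBall_zero_iff.mp hzr) hz) one_pos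
  rw [← h1, intervalIntegral.integral_of_le zero_le_one]
  refine (Real.le_norm_self _).trans ((norm_integral_le_lintegral_norm _).trans (le_of_eq ?_))
  congr 1
  refine setLIntegral_congr_fun measurableSet_Ioc fun t ht => ?_
  have hm : MeasurableSet {z | z ∈ Metric.closedBall 0 r ∧ expNegGreen r w z < t} :=
    Metric.isClosed_closedBall.measurableSet.inter
      (measurableSet_lt (measurable_expNegGreen r w) measurable_const)
  rw [greenSublevel_eq hw ht.1, norm_mul, Real.norm_of_nonneg (one_div_pos.mpr ht.1).le,
    Real.norm_of_nonneg (integral_nonneg h0), ENNReal.ofReal_mul (one_div_pos.mpr ht.1).le,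
    ofReal_setIntegral_eq hc h0 hm fun z hz => hz.1]

end Density

/-! ### Choice of the scale at a good point -/

theorem exp_mul_le {x : ℝ} (h1 : 3 / 10 ≤ x) (h2 : x ≤ 1) :
    (x / 5 + 3 / 8) * Real.exp x ≤ 2 * x := by
  have h := Real.exp_bound' (by linarith : 0 ≤ x) h2 (n := 3) (by norm_num)
  simp only [Finset.sum_range_succ, Finset.sum_range_zero, Nat.factorial] at h
  norm_num at h
  have h3 : (x / 5 + 3 / 8) * (1 + x + x ^ 2 / 2 + x ^ 3 * 4 / 18) ≤ 2 * x := by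
    have h4 := mul_nonneg (sub_nonneg.mpr h1) (sub_nonneg.mpr h2)
    nlinarith [mul_nonneg h4 (by linarith : 0 ≤ x), mul_nonneg h4 (sq_nonneg x)]
  refine le_trans (mul_le_mul_of_nonneg_left ?_ (by linarith)) h3
  linarith

theorem exp_three_tenths_le : Real.exp (3 / 10) ≤ 1.36 := by
  have h := Real.exp_bound' (x := 3 / 10) (by norm_num) (by norm_num) (n := 3) (by norm_num)
  simp only [Finset.sum_range_succ, Finset.sum_range_zero, Nat.factorial] at h
  norm_num at h ⊢
  linarith

/-- The scale `D` up to which the mass of disks about a good point is controlled is either limited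
by the distance `d` to the boundary, and then the bound by `2 d` is used if `D` is small, or the
bound by `3 r / 5` suffices. -/
theorem exists_log_add_le {r T d D : ℝ} (hr : 0 < r) (hT : 5 ≤ r * T) (hd : 0 < d)
    (hD : D = min (10 / 31 * d) (8 / (5 * T))) :
    ∃ c, 0 < c ∧ (c = 2 * d ∨ c = 3 / 5 * r) ∧
      Real.log (1 + c / D) + 5 / 8 * T * D ≤ Real.log T + Real.log r + Real.log 2 := by
  have hT0 : 0 < T := by
    by_contra hlt
    nlinarith
  have hD0 : 0 < D := by
    rw [hD]
    positivity
  have hlog : Real.log T + Real.log r + Real.log 2 = Real.log (2 * (r * T)) := by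
    rw [Real.log_mul (by norm_num) (by positivity), Real.log_mul hr.ne' hT0.ne']
    ring
  obtain ⟨x, hx⟩ : ∃ x, x = 5 / 8 * T * D := ⟨_, rfl⟩
  have hx0 : 0 < x := by
    rw [hx]
    positivity
  have hx1 : x ≤ 1 := by
    have h1 : D ≤ 8 / (5 * T) := hD ▸ min_le_right _ _
    rw [le_div_iff₀ (by positivity)] at h1
    linarith
  have key : ∀ c, 0 < c → (1 + c / D) * Real.exp x ≤ 2 * (r * T) →
      Real.log (1 + c / D) + 5 / 8 * T * D ≤ Real.log T + Real.log r + Real.log 2 := by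
    intro c hc h
    have h1 : 0 < 1 + c / D := by positivity
    rw [hlog, ← hx]
    have h2 := Real.log_le_log (by positivity) h
    rwa [Real.log_mul h1.ne' (Real.exp_pos x).ne', Real.log_exp] at h2
  -- With `x ≤ 3 / 10` the claim is `(36 / 5) e ^ x ≤ 2 r T`, true for `r T ≥ 5`; a larger `x` makes
  -- `D` large enough for the interior bound.
  rcases le_or_gt x (3 / 10) with hx3 | hx3
  · refine ⟨2 * d, by positivity, Or.inl rfl, key _ (by positivity) ?_⟩
    have hDd : D = 10 / 31 * d := by
      rcases min_choice (10 / 31 * d) (8 / (5 * T)) with h | h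
      · rw [hD, h]
      · rw [hx, hD, h] at hx3
        have : 5 / 8 * T * (8 / (5 * T)) = 1 := by field_simp
        linarith
    have h1 : 2 * d / D = 31 / 5 := by
      rw [hDd]
      field_simp
      norm_num
    have h2 := (Real.exp_le_exp.mpr hx3).trans exp_three_tenths_le
    rw [h1]
    linarith
  · refine ⟨3 / 5 * r, by positivity, Or.inr rfl, key _ (by positivity) ?_⟩
    have h1 : 3 / 5 * r / D = r * T / x * (3 / 8) := by
      rw [hx]
      field_simp
    have h2 : 1 ≤ r * T / x * (x / 5) := by
      field_simp
      linarith
    have h3 := mul_le_mul_of_nonneg_left (exp_mul_le hx3.le hx1)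
      (by positivity : 0 ≤ r * T / x)
    have h4 : r * T / x * (2 * x) = 2 * (r * T) := by field_simp
    have h5 := mul_le_mul_of_nonneg_right h2 (Real.exp_pos x).le
    rw [h1]
    linarith

/-! ### Good points and covering of the bad points -/

/-- The mass of `μ` on the closed disk, weighted by the Green function of the disk of radius `e r`
with pole at the origin. -/
noncomputable def weightedMeasure (μ : Measure ℂ) (r : ℝ) : Measure ℂ :=
  (μ.restrict (Metric.closedBall 0 r)).withDensity
    fun z => ENNReal.ofReal (1 + Real.log (r / ‖z‖))

instance (μ : Measure ℂ) [SFinite μ] (r : ℝ) : SFinite (weightedMeasure μ r) := by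
  unfold weightedMeasure
  infer_instance

theorem weightedMeasure_univ_le {μ : Measure ℂ} {r : ℝ} (hr : 0 < r) (hμ : ∀ᵐ z ∂μ, z ≠ 0) :
    weightedMeasure μ r Set.univ ≤
      ∫⁻ z, ENNReal.ofReal (Real.log (Real.exp 1 * r / ‖z‖)) ∂μ := by
  rw [weightedMeasure, withDensity_apply _ MeasurableSet.univ, Measure.restrict_univ]
  refine (lintegral_mono_ae ?_).trans (setLIntegral_le_lintegral _ _)
  filter_upwards [ae_restrict_of_ae hμ] with z hz
  have hz' : 0 < ‖z‖ := norm_pos_iff.mpr hz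
  rw [mul_div_assoc, Real.log_mul (Real.exp_pos 1).ne' (by positivity), Real.log_exp]

/-- The Green potential at a point `w` about which the weighted mass of small disks grows at most
linearly, up to the scale `D`. The constant `c` is any of the two that bound the Green function. -/
theorem lintegral_log_expNegGreen_le {μ : Measure ℂ} [SFinite μ] {r κ m D c : ℝ} {w : ℂ}
    (hw : ‖w‖ < r) (hκ : 0 ≤ κ) (hm : 0 ≤ m) (hD : 0 < D) (hc : 0 < c)
    (hcd : c = 2 * (r - ‖w‖) ∨ c = 3 / 5 * r) (hμ : ∀ a, ∀ᵐ z ∂μ, z ≠ a)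
    (hν : weightedMeasure μ r Set.univ ≤ ENNReal.ofReal m)
    (hball : ∀ t, 0 < t → t ≤ D →
      weightedMeasure μ r (Metric.closedBall w t) ≤ ENNReal.ofReal (κ * t)) :
    ∫⁻ z in Metric.closedBall 0 r, ENNReal.ofReal (Real.log (1 / expNegGreen r w z)) ∂μ ≤
      ENNReal.ofReal (m * Real.log (1 + c / D) + κ * D) := by
  have hk : 0 ≤ Real.log (1 + c / D) := Real.log_nonneg (by
    have : 0 < c / D := by positivity
    linarith)
  have hνw : weightedMeasure μ r {w} = 0 :=
    ((withDensity_absolutelyContinuous _ _).trans Measure.absolutelyContinuous_restrict)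
      (by simpa [ae_iff] using hμ w)
  have hpt : ∀ z : ℂ, ‖z‖ ≤ r → z ≠ 0 → z ≠ w →
      ENNReal.ofReal (Real.log (1 / expNegGreen r w z)) ≤
        ENNReal.ofReal (1 + Real.log (r / ‖z‖)) *
          (ENNReal.ofReal (Real.log (1 + c / D)) + ENNReal.ofReal (Real.log (D / ‖z - w‖))) := by
    intro z hz hz0 hzw
    have hs : 0 < ‖z - w‖ := norm_pos_iff.mpr (sub_ne_zero.mpr hzw)
    have hz' : 0 < ‖z‖ := norm_pos_iff.mpr hz0
    have hlog : 0 ≤ Real.log (r / ‖z‖) := Real.log_nonneg ((one_le_div hz').mpr hz)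
    have hcs : 0 < c / ‖z - w‖ := by positivity
    have hcD : 0 < c / D := by positivity
    have h1 : Real.log (1 / expNegGreen r w z) ≤
        (1 + Real.log (r / ‖z‖)) * Real.log (1 + c / ‖z - w‖) := by
      rcases hcd with rfl | rfl
      · refine (log_inv_expNegGreen_le_boundary hw hz hzw).trans ?_
        have := Real.log_nonneg (by linarith : 1 ≤ 1 + 2 * (r - ‖w‖) / ‖z - w‖)
        nlinarith
      · exact log_inv_expNegGreen_le_weight hw hz hzw hz0
    refine (ENNReal.ofReal_le_ofReal h1).trans ?_
    rw [ENNReal.ofReal_mul (by linarith)]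
    gcongr
    rcases le_or_gt D ‖z - w‖ with hDs | hDs
    · refine le_add_right (ENNReal.ofReal_le_ofReal (Real.log_le_log (by linarith) ?_))
      gcongr
    · rw [← ENNReal.ofReal_add hk (Real.log_nonneg ((one_le_div hs).mpr hDs.le)),
        ← Real.log_mul (by positivity) (by positivity)]
      refine ENNReal.ofReal_le_ofReal (Real.log_le_log (by positivity) ?_)
      have h2 : (1 + c / D) * (D / ‖z - w‖) = D / ‖z - w‖ + c / ‖z - w‖ := by field_simp
      have h3 := (one_le_div hs).mpr hDs.le
      rw [h2]
      linarith
  have hmeas : Measurable fun z : ℂ =>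
      ENNReal.ofReal (Real.log (1 + c / D)) + ENNReal.ofReal (Real.log (D / ‖z - w‖)) := by
    fun_prop
  calc ∫⁻ z in Metric.closedBall 0 r, ENNReal.ofReal (Real.log (1 / expNegGreen r w z)) ∂μ
      ≤ ∫⁻ z in Metric.closedBall 0 r, ENNReal.ofReal (1 + Real.log (r / ‖z‖)) *
          (ENNReal.ofReal (Real.log (1 + c / D)) + ENNReal.ofReal (Real.log (D / ‖z - w‖))) ∂μ := by
        refine lintegral_mono_ae ?_
        filter_upwards [ae_restrict_of_ae (hμ 0), ae_restrict_of_ae (hμ w),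
          ae_restrict_mem (Metric.isClosed_closedBall (x := (0 : ℂ)) (ε := r)).measurableSet]
          with z h1 h2 h3
        exact hpt z (mem_closedBall_zero_iff.mp h3) h1 h2
    _ = ∫⁻ z, (ENNReal.ofReal (Real.log (1 + c / D)) + ENNReal.ofReal (Real.log (D / ‖z - w‖)))
          ∂weightedMeasure μ r := by
        rw [weightedMeasure, lintegral_withDensity_eq_lintegral_mul _ (by fun_prop) hmeas]
        rfl
    _ = ENNReal.ofReal (Real.log (1 + c / D)) * weightedMeasure μ r Set.univ +
          ∫⁻ z, ENNReal.ofReal (Real.log (D / ‖z - w‖)) ∂weightedMeasure μ r := by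
        rw [lintegral_add_left measurable_const, lintegral_const]
    _ ≤ ENNReal.ofReal (Real.log (1 + c / D)) * ENNReal.ofReal m + ENNReal.ofReal (κ * D) := by
        gcongr
        exact lintegral_log_le_of_measure_closedBall_le hD hκ hball hνw
    _ = ENNReal.ofReal (m * Real.log (1 + c / D) + κ * D) := by
        rw [← ENNReal.ofReal_mul hk, ← ENNReal.ofReal_add (by positivity) (by positivity), mul_comm]

theorem exists_nat_balls {ι : Type*} [Countable ι] (x : ι → ℂ) (t : ι → ℝ≥0) :
    ∃ (c : ℕ → ℂ) (ρ : ℕ → ℝ≥0),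
      (⋃ n, Metric.ball (c n) (ρ n : ℝ)) = ⋃ i, Metric.ball (x i) (t i : ℝ) ∧
      ∑' n, (ρ n : ℝ≥0∞) = ∑' i, (t i : ℝ≥0∞) := by
  obtain ⟨g, hg⟩ := exists_injective_nat ι
  have hout : ∀ n, (∃ i, g i = n) ∨ Function.extend g t 0 n = 0 := fun n =>
    (em _).imp_right fun h => Function.extend_apply' _ _ _ h
  refine ⟨Function.extend g x 0, Function.extend g t 0, ?_, ?_⟩
  · ext z
    simp only [Set.mem_iUnion]
    constructor
    · rintro ⟨n, hn⟩
      rcases hout n with ⟨i, rfl⟩ | h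
      · rw [hg.extend_apply, hg.extend_apply] at hn
        exact ⟨i, hn⟩
      · simp [h] at hn
    · rintro ⟨i, hi⟩
      exact ⟨g i, by rwa [hg.extend_apply, hg.extend_apply]⟩
  · rw [← tsum_extend_zero hg (fun i => (t i : ℝ≥0∞))]
    refine tsum_congr fun n => ?_
    by_cases h : ∃ i, g i = n
    · obtain ⟨i, rfl⟩ := h
      rw [hg.extend_apply, hg.extend_apply]
    · rw [Function.extend_apply' _ _ _ h, Function.extend_apply' _ _ _ h]
      simp

/-- The points of the disk about which `ν` has too much mass at a scale smaller than the distance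
to the boundary are covered by few disks that do not leave the disk of radius `r`. -/
theorem exists_balls_covering {ν : Measure ℂ} {r κ m : ℝ} (hκ : 0 < κ)
    (hν : ν Set.univ ≤ ENNReal.ofReal m) :
    ∃ (c : ℕ → ℂ) (ρ : ℕ → ℝ≥0),
      (⋃ n, Metric.ball (c n) (ρ n)) ⊆ Metric.ball (0 : ℂ) r ∧
      ∑' n, (ρ n : ℝ≥0∞) ≤ ENNReal.ofReal (31 / 10 * (m / κ)) ∧
      ∀ w ∈ Metric.ball (0 : ℂ) r, w ∉ (⋃ n, Metric.ball (c n) (ρ n)) →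
        ∀ t, 0 < t → t ≤ 10 / 31 * (r - ‖w‖) →
          ν (Metric.closedBall w t) ≤ ENNReal.ofReal (κ * t) := by
  let B : Set ℂ := {w | w ∈ Metric.ball (0 : ℂ) r ∧ ∃ t, 0 < t ∧ t ≤ 10 / 31 * (r - ‖w‖) ∧
    ENNReal.ofReal (κ * t) < ν (Metric.closedBall w t)}
  choose! t ht0 htd htν using fun w (hw : w ∈ B) => hw.2
  obtain ⟨u, huB, hud, hcov⟩ := Vitali.exists_disjoint_subfamily_covering_enlargement_closedBall B
    (fun w => w) t r (fun w hw => by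
      have h1 := htd w hw
      have h2 := ht0 w hw
      have h3 := norm_nonneg w
      linarith) (61 / 20) (by norm_num)
  -- Closed balls of radius `61 / 20 * t` sit in the open balls of radius `31 / 10 * t`, which do
  -- not leave the disk as `t w ≤ 10 / 31 * (r - ‖w‖)`.
  have hcount : u.Countable := hud.countable_of_nonempty_interior fun w hw =>
    ⟨w, Metric.ball_subset_interior_closedBall (Metric.mem_ball_self (ht0 w (huB hw)))⟩
  have : Countable u := hcount.to_subtype
  obtain ⟨c, ρ, hU, hsum⟩ := exists_nat_balls (fun w : u => (w : ℂ))
    (fun w : u => (31 / 10 * t w).toNNReal)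
  have hrad : ∀ w : u, ((31 / 10 * t w).toNNReal : ℝ) = 31 / 10 * t w := fun w =>
    Real.coe_toNNReal _ (by
      have := ht0 w (huB w.2)
      positivity)
  simp only [hrad] at hU
  refine ⟨c, ρ, ?_, ?_, ?_⟩
  · rw [hU]
    refine Set.iUnion_subset fun w => Metric.ball_subset_ball' ?_
    have := htd w (huB w.2)
    rw [dist_zero_right]
    linarith
  · rw [hsum]
    have h1 : ∀ w : u, ((31 / 10 * t w).toNNReal : ℝ≥0∞) =
        ENNReal.ofReal (31 / 10 / κ) * ENNReal.ofReal (κ * t w) := by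
      intro w
      rw [← ENNReal.ofReal_mul (by positivity)]
      change ENNReal.ofReal _ = _
      congr 1
      field_simp
    simp_rw [h1]
    rw [ENNReal.tsum_mul_left]
    have h2 : ∑' w : u, ENNReal.ofReal (κ * t w) ≤ ENNReal.ofReal m := by
      refine le_trans (ENNReal.tsum_le_tsum fun w => (htν w (huB w.2)).le) (le_trans ?_ hν)
      exact tsum_measure_le_measure_univ
        (fun w => Metric.isClosed_closedBall.measurableSet.nullMeasurableSet)
        fun a b hab => (hud a.2 b.2 (Subtype.coe_injective.ne hab)).aedisjoint
    refine (mul_le_mul_right h2 _).trans ?_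
    rw [← ENNReal.ofReal_mul (by positivity)]
    exact ENNReal.ofReal_le_ofReal (le_of_eq (by ring))
  · intro w hwr hw s hs0 hsd
    by_contra! hlt
    have hwB : w ∈ B := ⟨hwr, s, hs0, hsd, hlt⟩
    obtain ⟨b, hb, hsub⟩ := hcov w hwB
    apply hw
    rw [hU, Set.mem_iUnion]
    refine ⟨⟨b, hb⟩, ?_⟩
    have h1 := hsub (Metric.mem_closedBall_self (ht0 w hwB).le)
    have h2 := ht0 b (huB hb)
    exact Metric.closedBall_subset_ball (by linarith) h1

/-- The estimate for a continuous nonnegative density. If `r T(r) < 5`, the whole disk is an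
admissible exceptional set. -/
theorem exists_exceptional_balls {h : ℂ → ℝ} (hc : Continuous h) (h0 : ∀ z, 0 ≤ h z)
    {T : ℝ → ℝ} (hT : T = fun R => ∫ t in (0 : ℝ)..R, 1 / t * ∫ z in Metric.ball 0 t, h z)
    {r : ℝ} (hr : 0 < r) :
    ∃ (c : ℕ → ℂ) (ρ : ℕ → ℝ≥0),
      (⋃ n, Metric.ball (c n) (ρ n)) ⊆ Metric.ball (0 : ℂ) r ∧
      (∑' n, (ρ n : ℝ≥0∞)) < 5 / ENNReal.ofReal (T r) ∧
      ∀ w ∈ Metric.ball (0 : ℂ) r, w ∉ (⋃ n, Metric.ball (c n) (ρ n)) →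
        ∫ t in (0 : ℝ)..1, 1 / t * ∫ z in greenSublevel r w t, h z ≤
          (Real.log (T r) + Real.log r + Real.log 2) * T (Real.exp 1 * r) := by
  rcases lt_or_ge (r * T r) 5 with hsmall | hbig
  · obtain ⟨c, ρ, hU, hsum⟩ := exists_nat_balls (fun _ : Unit => (0 : ℂ)) (fun _ => r.toNNReal)
    rw [Set.iUnion_const, Real.coe_toNNReal r hr.le] at hU
    refine ⟨c, ρ, hU.subset, ?_, fun w hw hn => absurd (hU ▸ hw) hn⟩
    rw [hsum, tsum_fintype, Fintype.sum_unique]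
    change ENNReal.ofReal r < _
    rw [ENNReal.lt_div_iff_mul_lt (by simp) (by simp), ← ENNReal.ofReal_mul hr.le]
    refine (ENNReal.ofReal_lt_ofReal_iff (by norm_num : (0 : ℝ) < 5)).mpr hsmall |>.trans_le ?_
    simp
  · have hT0 : 0 < T r := by
      by_contra hlt
      nlinarith
    have her : r ≤ Real.exp 1 * r := by
      have := Real.add_one_le_exp (1 : ℝ)
      nlinarith
    have hm : T r ≤ T (Real.exp 1 * r) := by
      have h1 := ofReal_charFun_eq hc h0 hr
      have h2 := ofReal_charFun_eq hc h0 (hr.trans_le her)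
      have h3 : ENNReal.ofReal (T r) ≤ ENNReal.ofReal (T (Real.exp 1 * r)) := by
        rw [hT]
        simp only
        rw [h1, h2]
        refine lintegral_mono_ae ?_
        filter_upwards [ae_ne_densityMeasure h 0] with z hz
        have hz' : 0 < ‖z‖ := norm_pos_iff.mpr hz
        gcongr
      by_contra! hlt
      exact absurd h3 (not_le.mpr ((ENNReal.ofReal_lt_ofReal_iff hT0).mpr hlt))
    have hm0 : 0 < T (Real.exp 1 * r) := hT0.trans_le hm
    set m := T (Real.exp 1 * r) with hmdef
    have hν : weightedMeasure (densityMeasure h) r Set.univ ≤ ENNReal.ofReal m := by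
      refine (weightedMeasure_univ_le hr (ae_ne_densityMeasure h 0)).trans (le_of_eq ?_)
      rw [hmdef, hT]
      exact (ofReal_charFun_eq hc h0 (hr.trans_le her)).symm
    -- The critical scale is `m / κ = 8 / (5 T(r))`: the disks have sum of radii at most
    -- `(31 / 10) (8 / 5) / T(r) < 5 / T(r)`.
    obtain ⟨c, ρ, hsub, hsum, hgood⟩ := exists_balls_covering (r := r)
      (κ := m * (5 / 8 * T r)) (by positivity) hν
    refine ⟨c, ρ, hsub, hsum.trans_lt ?_, fun w hw hn => ?_⟩
    · rw [show (5 : ℝ≥0∞) = ENNReal.ofReal 5 by simp, ← ENNReal.ofReal_div_of_pos hT0,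
        ENNReal.ofReal_lt_ofReal_iff (by positivity)]
      have h1 : 31 / 10 * (m / (m * (5 / 8 * T r))) = 124 / 25 / T r := by
        field_simp
        norm_num
      rw [h1]
      gcongr
      norm_num
    · have hw' : ‖w‖ < r := mem_ball_zero_iff.mp hw
      obtain ⟨D, hD⟩ : ∃ D, D = min (10 / 31 * (r - ‖w‖)) (8 / (5 * T r)) := ⟨_, rfl⟩
      obtain ⟨c', hc', hcd, hlog⟩ := exists_log_add_le hr hbig (sub_pos.mpr hw') hD
      have hd := sub_pos.mpr hw'
      have hD0 : 0 < D := by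
        rw [hD]
        positivity
      have h1 := lintegral_log_expNegGreen_le (μ := densityMeasure h) hw'
        (κ := m * (5 / 8 * T r)) (by positivity) hm0.le hD0 hc' hcd (ae_ne_densityMeasure h) hν
        (fun t ht htD => hgood w hw hn t ht (htD.trans (hD ▸ min_le_left _ _)))
      have h2 : m * Real.log (1 + c' / D) + m * (5 / 8 * T r) * D ≤
          (Real.log (T r) + Real.log r + Real.log 2) * m := by
        have := mul_le_mul_of_nonneg_left hlog hm0.le
        linarith
      have h3 : 0 ≤ (Real.log (T r) + Real.log r + Real.log 2) * m := by
        refine le_trans ?_ h2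
        have : 0 ≤ Real.log (1 + c' / D) := Real.log_nonneg (by
          have : 0 < c' / D := by positivity
          linarith)
        positivity
      exact (charFunAt_le_toReal_lintegral hc h0 hw').trans
        (ENNReal.toReal_le_of_le_ofReal h3 (h1.trans (ENNReal.ofReal_le_ofReal h2)))

end EntireCurve

theorem theorem3p6 {N : ℕ} (X : Set (EntireCurve.PSpace N))
    (hX : EntireCurve.IsProjectiveAlgebraic X)
    (M : EntireCurve.HermitianMetric X) (hM : M.IsPositive)
    (φ : ℂ → X) (hφ : EntireCurve.IsHolomorphicCurve φ) (r : ℝ) (hr : 0 < r) :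
    ∃ (c : ℕ → ℂ) (ρ : ℕ → ℝ≥0),
      (⋃ n, Metric.ball (c n) (ρ n)) ⊆ Metric.ball (0 : ℂ) r ∧
      (∑' n, (ρ n : ℝ≥0∞)) < 5 / ENNReal.ofReal (EntireCurve.charFun M φ r) ∧
      ∀ w₀ ∈ Metric.ball (0 : ℂ) r, w₀ ∉ (⋃ n, Metric.ball (c n) (ρ n)) →
        EntireCurve.charFunAt M φ w₀ r ≤
          (Real.log (EntireCurve.charFun M φ r) + Real.log r + Real.log 2) *
            EntireCurve.charFun M φ (Real.exp 1 * r) :=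
  EntireCurve.exists_exceptional_balls (EntireCurve.continuous_chernDensity hM hφ)
    (EntireCurve.chernDensity_nonneg hM hφ) (T := EntireCurve.charFun M φ) rfl hr
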